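/- \textbf{Setting.} Let $M\ge 1$ and $N\ge 0$ be integers, $F\in\mathbb{R}^{M\times N}$, $\sigma>0$ (known), $\lambda>0$, and write $\theta(F,x)=Fx/\sqrt N$. Let $f(\cdot\mid t)$ be the density of $\mathcal N(t,\sigma^2)$ and $\ln f(y\mid\theta)=\sum_{\mu=1}^M\ln f(y_\mu\mid\theta_\mu)$. A LASSO estimate for the data $y\in\mathbb{R}^M$ is any $$\hat x(y)\in\operatorname*{argmax}_{x\in\mathbb{R}^N}\big\{\ln f(y\mid\theta(F,x))-\lambda\|x\|_1\big\},$$ and $\hat y(y)=\theta(F,\hat x(y))$. Let $\|x\|_0$ be the number of nonzero components of $x$. The training data are distributed as $y\sim\mathcal N(m,\sigma^2 I_M)$, with arbitrary $m\in\mathbb{R}^M$. Define $$\mathrm{err}_{\rm train}(y)=-\tfrac1M\sum_{\mu}\ln f(y_\mu\mid\hat y_\mu(y)),\qquad \mathrm{err}^{(\rm in)}_{\rm pre}(y)=-\tfrac1M\sum_{\mu}\mathbb{E}_{z_\mu\sim\mathcal N(m_\mu,\sigma^2)}\big[\ln f(z_\mu\mid\hat y_\mu(y))\big],$$ the covariance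 penalty $\Delta=\frac{1}{\sigma^2M}\sum_{\mu}\mathrm{Cov}_y(y_\mu,\hat y_\mu(y))$, the generalized degrees of freedom $\mathrm{gdf}(y)=\frac1M\sum_\mu\partial\hat y_\mu/\partial y_\mu$, and $$C_p(y)=2\sigma^2\,\mathrm{err}_{\rm train}(y)+2\sigma^2\,\mathrm{gdf}(y),\qquad \mathrm{AIC}(y)=2\Big(\mathrm{err}_{\rm train}(y)+\frac{\|\hat x(y)\|_0}{M}\Big).$$ \textbf{Theorem.} (a) Suppose that $F$ is such that the LASSO estimate is unique for Lebesgue-almost every $y\in\mathbb{R}^M$. Then, for every $m\in\mathbb{R}^M$ and every choice of LASSO estimates $y\mapsto\hat x(y)$: (i) the $\hat y_\mu$ are square integrable, and $\|\hat x(y)\|_0/M$ is an unbiased estimator of the covariance penalty: $\mathbb{E}_y\big[\|\hat x(y)\|_0/M\big]=\Delta$; (ii) almost surely, $\hat y$ is differentiable at $y$ and $\mathrm{gdf}(y)=\|\hat x(y)\|_0/M$; hence $C_p(y)=\sigma^2\,\mathrm{AIC}(y)$ almost surely; (iii) $C_p$ and $\mathrm{AIC}$ are unbiased estimators of the in-sample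 prediction error, up to the conventional factors: all the expectations that follow are finite, and $\mathbb{E}_y[C_p(y)]=2\sigma^2\,\mathbb{E}_y[\mathrm{err}^{(\rm in)}_{\rm pre}(y)]$ and $\mathbb{E}_y[\mathrm{AIC}(y)]=2\,\mathbb{E}_y[\mathrm{err}^{(\rm in)}_{\rm pre}(y)]$. (b) If the entries of $F$ are independent standard Gaussian variables, then almost surely the LASSO estimate is unique for every $y\in\mathbb{R}^M$, so that (a) applies to almost every such $F$. -/

import Mathlib

open MeasureTheory ProbabilityTheory
open scoped Matrix NNReal

namespace Lasso

/-- The linear predictor `θ(F, x) = F x / √N`. It is also the fitted value of the data when `x` is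
the estimated regression coefficient. -/
noncomputable def theta {M N : ℕ} (F : Matrix (Fin M) (Fin N) ℝ) (x : Fin N → ℝ) : Fin M → ℝ :=
  fun i => (F *ᵥ x) i / √(N : ℝ)

/-- The noise variance `σ²` as a nonnegative real. -/
noncomputable def noiseVar (σ : ℝ) : ℝ≥0 := ⟨σ ^ 2, sq_nonneg σ⟩

/-- The separable Gaussian log-likelihood `ln f(y | θ) = ∑ i, ln f(y i | θ i)` with known
variance `σ²`, where `f(· | t)` is the density of `N(t, σ²)`. -/
noncomputable def logLik {M : ℕ} (σ : ℝ) (y θ : Fin M → ℝ) : ℝ :=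
  ∑ i, Real.log (gaussianPDFReal (θ i) (noiseVar σ) (y i))

/-- The objective of the penalized maximum likelihood method with `ℓ₁` penalty,
`φ(D, x) = ln f(y | θ(F, x)) - lam * ‖x‖₁`. -/
noncomputable def objective {M N : ℕ} (σ lam : ℝ) (F : Matrix (Fin M) (Fin N) ℝ)
    (y : Fin M → ℝ) (x : Fin N → ℝ) : ℝ :=
  logLik σ y (theta F x) - lam * ∑ j, |x j|

/-- `x` is a LASSO estimate for the data `(y, F)`: a global maximizer of the objective. -/
def IsEstimate {M N : ℕ} (σ lam : ℝ) (F : Matrix (Fin M) (Fin N) ℝ)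
    (y : Fin M → ℝ) (x : Fin N → ℝ) : Prop :=
  ∀ x' : Fin N → ℝ, objective σ lam F y x' ≤ objective σ lam F y x

/-- The law `N(m, σ² I_M)` of the training data. -/
noncomputable def dataLaw {M : ℕ} (σ : ℝ) (m : Fin M → ℝ) : Measure (Fin M → ℝ) :=
  Measure.pi fun i => gaussianReal (m i) (noiseVar σ)

/-- The training error `-(1/M) ∑ i, ln f(y i | θ i)` at the estimated coefficient `x`. -/
noncomputable def errTrain {M N : ℕ} (σ : ℝ) (F : Matrix (Fin M) (Fin N) ℝ)
    (y : Fin M → ℝ) (x : Fin N → ℝ) : ℝ :=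
  -(1 / (M : ℝ)) * logLik σ y (theta F x)

/-- The in-sample prediction error `-(1/M) ∑ i, E[ln f(z i | θ i)]` at the estimated coefficient
`x`, where `z i ∼ N(m i, σ²)` is a new observation at the `i`-th training point. -/
noncomputable def errIn {M N : ℕ} (σ : ℝ) (F : Matrix (Fin M) (Fin N) ℝ)
    (m : Fin M → ℝ) (x : Fin N → ℝ) : ℝ :=
  -(1 / (M : ℝ)) * ∑ i, ∫ z, Real.log (gaussianPDFReal (theta F x i) (noiseVar σ) z)
    ∂(gaussianReal (m i) (noiseVar σ))

/-- The covariance penalty `(1 / (σ² M)) Cov_y(y, ŷ)`, where `ŷ = θ(F, x̂(y))` and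
`Cov_y(y, ŷ) = ∑ i, Cov(y i, ŷ i)`. -/
noncomputable def covPenalty {M N : ℕ} (σ : ℝ) (F : Matrix (Fin M) (Fin N) ℝ)
    (m : Fin M → ℝ) (xhat : (Fin M → ℝ) → Fin N → ℝ) : ℝ :=
  1 / (σ ^ 2 * (M : ℝ)) *
    ∑ i, covariance (fun y => y i) (fun y => theta F (xhat y) i) (dataLaw σ m)

/-- The generalized degrees of freedom `(1/M) ∑ i, ∂ŷ i / ∂y i`. -/
noncomputable def gdf {M N : ℕ} (F : Matrix (Fin M) (Fin N) ℝ)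
    (xhat : (Fin M → ℝ) → Fin N → ℝ) (y : Fin M → ℝ) : ℝ :=
  1 / (M : ℝ) * ∑ i, deriv (fun t => theta F (xhat (Function.update y i t)) i) (y i)

/-- The `C_p` criterion (in the form for general estimators, with the generalized degrees of
freedom as the degrees of freedom): `2σ² err_train + 2σ² gdf`. -/
noncomputable def Cp {M N : ℕ} (σ : ℝ) (F : Matrix (Fin M) (Fin N) ℝ)
    (xhat : (Fin M → ℝ) → Fin N → ℝ) (y : Fin M → ℝ) : ℝ :=
  2 * σ ^ 2 * errTrain σ F y (xhat y) + 2 * σ ^ 2 * gdf F xhat y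

/-- The number of nonzero estimated coefficients divided by the number of data, `‖x̂‖₀ / M`. -/
noncomputable def paramRatio {N : ℕ} (M : ℕ) (x : Fin N → ℝ) : ℝ :=
  (hammingNorm x : ℝ) / (M : ℝ)

/-- Akaike's information criterion `2 (err_train + ‖x̂‖₀ / M)`. -/
noncomputable def AIC {M N : ℕ} (σ : ℝ) (F : Matrix (Fin M) (Fin N) ℝ)
    (xhat : (Fin M → ℝ) → Fin N → ℝ) (y : Fin M → ℝ) : ℝ :=
  2 * (errTrain σ F y (xhat y) + paramRatio M (xhat y))

/-- `T` is an unbiased estimator of the (possibly data dependent) target `g` under the law `P`: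
both have finite expectations, and these agree. -/
def IsUnbiased {Ω : Type*} [MeasurableSpace Ω] (P : Measure Ω) (T g : Ω → ℝ) : Prop :=
  Integrable T P ∧ Integrable g P ∧ ∫ ω, T ω ∂P = ∫ ω, g ω ∂P

/-- The law of a predictor matrix with independent standard Gaussian entries. -/
noncomputable def gaussianPredictors (M N : ℕ) : Measure (Fin M → Fin N → ℝ) :=
  Measure.pi fun _ => Measure.pi fun _ => gaussianReal 0 1

end Lasso

namespace Lasso

open Filter Topology

variable {M N : ℕ}

/-! The objective is concave, so an estimate satisfies a variational inequality. Adding the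
inequalities for two data vectors shows that the fit `ŷ` is firmly nonexpansive, hence Lipschitz.
This regularity is enough for Stein's identity under the Gaussian law (`integral_sub_mul_dataLaw`),
which turns `Cov(y i, ŷ i)` into `σ²` times the mean of `∂ŷ i / ∂y i`. The mean of `gdf` is
therefore the covariance penalty, and the statements on prediction error follow by expanding
squares.

It remains to compute the divergence of the fit (`ae_trace_fderiv_fit`). Among data whose estimates
share a sign pattern, stationarity fixes the inner products of the residual with the active columns,
so the fit moves by orthogonal projection onto their span. There are finitely many patterns, so
almost everywhere the derivative is such a projection, whose trace is the dimension of the span.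
Uniqueness makes the active columns independent, and this dimension is `‖x̂‖₀`.

For Gaussian predictors, two estimates share their fit, hence their residual `r`. The active
columns, multiplied by their signs, all lie on the hyperplane `r ⬝ᵥ u = lam * σ ^ 2`, so a linear
relation expressing one through others is an affine one. An affine relation with at most `M` other
columns has probability zero, because at most `M` points span a proper affine subspace of `ℝ^M`. -/

/-! ### The Gaussian log-likelihood and the linear predictor. -/

theorem noiseVar_ne_zero {σ : ℝ} (hσ : 0 < σ) : noiseVar σ ≠ 0 := fun h =>
  (pow_pos hσ 2).ne' (congrArg NNReal.toReal h)

@[simp] theorem coe_noiseVar (σ : ℝ) : (noiseVar σ : ℝ) = σ ^ 2 := rfl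

theorem log_gaussianPDFReal {σ : ℝ} (hσ : 0 < σ) (t y : ℝ) :
    Real.log (gaussianPDFReal t (noiseVar σ) y) =
      -Real.log √(2 * Real.pi * σ ^ 2) - (y - t) ^ 2 / (2 * σ ^ 2) := by
  have h : 0 < √(2 * Real.pi * σ ^ 2) := by positivity
  rw [gaussianPDFReal, coe_noiseVar, Real.log_mul (inv_ne_zero h.ne') (Real.exp_ne_zero _),
    Real.log_exp, Real.log_inv]
  ring

theorem logLik_eq {σ : ℝ} (hσ : 0 < σ) (y θ : Fin M → ℝ) :
    logLik σ y θ = -(M * Real.log √(2 * Real.pi * σ ^ 2)) -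
      (∑ i, (y i - θ i) ^ 2) / (2 * σ ^ 2) := by
  simp [logLik, log_gaussianPDFReal hσ, Finset.sum_sub_distrib, Finset.sum_div]

/-- The linear predictor as a linear map. -/
noncomputable def thetaLin (F : Matrix (Fin M) (Fin N) ℝ) : (Fin N → ℝ) →ₗ[ℝ] (Fin M → ℝ) :=
  (√(N : ℝ))⁻¹ • F.mulVecLin

theorem thetaLin_apply (F : Matrix (Fin M) (Fin N) ℝ) (x : Fin N → ℝ) :
    thetaLin F x = theta F x := by
  ext i
  simp [thetaLin, theta, div_eq_inv_mul]

/-- The columns of the rescaled predictor matrix. -/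
noncomputable def column (F : Matrix (Fin M) (Fin N) ℝ) (j : Fin N) : Fin M → ℝ :=
  theta F (Pi.single j 1)

theorem theta_eq_sum (F : Matrix (Fin M) (Fin N) ℝ) (x : Fin N → ℝ) :
    theta F x = ∑ j, x j • column F j := by
  simp only [column, ← thetaLin_apply]
  conv_lhs => rw [← Finset.univ_sum_single x]
  rw [map_sum]
  refine Finset.sum_congr rfl fun j _ => ?_
  rw [← map_smul, ← Pi.single_smul, smul_eq_mul, mul_one]

theorem objective_eq {σ : ℝ} (hσ : 0 < σ) (lam : ℝ) (F : Matrix (Fin M) (Fin N) ℝ)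
    (y : Fin M → ℝ) (x : Fin N → ℝ) :
    objective σ lam F y x = -(M * Real.log √(2 * Real.pi * σ ^ 2)) -
      ((y - theta F x) ⬝ᵥ (y - theta F x)) / (2 * σ ^ 2) - lam * ∑ j, |x j| := by
  simp [objective, logLik_eq hσ, dotProduct, sq]

/-! ### Optimality conditions. -/

/-- The variational inequality satisfied by a LASSO estimate. -/
theorem IsEstimate.variational {σ lam : ℝ} (hσ : 0 < σ) (hlam : 0 < lam)
    {F : Matrix (Fin M) (Fin N) ℝ} {y : Fin M → ℝ} {x : Fin N → ℝ}
    (h : IsEstimate σ lam F y x) (x' : Fin N → ℝ) :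
    (y - theta F x) ⬝ᵥ (theta F x' - theta F x) ≤
      lam * σ ^ 2 * (∑ j, |x' j| - ∑ j, |x j|) := by
  set r := y - theta F x with hr
  set d := theta F x' - theta F x with hd
  have hσ2 : 0 < σ ^ 2 := by positivity
  -- Compare `x` with the point at fraction `t` of the segment to `x'` and divide by `t`; the
  -- quadratic remainder disappears as `t → 0`.
  have key : ∀ t : ℝ, 0 < t → t ≤ 1 →
      r ⬝ᵥ d ≤ t / 2 * (d ⬝ᵥ d) + lam * σ ^ 2 * (∑ j, |x' j| - ∑ j, |x j|) := by
    intro t ht ht1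
    have h1 := h (x + t • (x' - x))
    have hfit : y - theta F (x + t • (x' - x)) = r - t • d := by
      rw [hr, hd]
      simp only [← thetaLin_apply, map_add, map_smul, map_sub]
      abel
    have hnorm : ∑ j, |(x + t • (x' - x)) j| ≤ (1 - t) * ∑ j, |x j| + t * ∑ j, |x' j| := by
      rw [Finset.mul_sum, Finset.mul_sum, ← Finset.sum_add_distrib]
      refine Finset.sum_le_sum fun j _ => ?_
      have : (x + t • (x' - x)) j = (1 - t) * x j + t * x' j := by
        simp only [Pi.add_apply, Pi.smul_apply, Pi.sub_apply, smul_eq_mul]; ring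
      rw [this]
      refine (abs_add_le _ _).trans (le_of_eq ?_)
      rw [abs_mul, abs_mul, abs_of_nonneg (sub_nonneg.2 ht1), abs_of_pos ht]
    rw [objective_eq hσ, objective_eq hσ, hfit, ← hr] at h1
    have hexp : (r - t • d) ⬝ᵥ (r - t • d) = r ⬝ᵥ r - 2 * t * (r ⬝ᵥ d) + t ^ 2 * (d ⬝ᵥ d) := by
      simp only [sub_dotProduct, dotProduct_sub, smul_dotProduct, dotProduct_smul, smul_eq_mul]
      rw [dotProduct_comm d r]; ring
    rw [hexp] at h1
    have h2 : (r ⬝ᵥ r) / (2 * σ ^ 2) + lam * ∑ j, |x j| ≤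
        (r ⬝ᵥ r - 2 * t * (r ⬝ᵥ d) + t ^ 2 * (d ⬝ᵥ d)) / (2 * σ ^ 2) +
          lam * ((1 - t) * ∑ j, |x j| + t * ∑ j, |x' j|) := by
      have := mul_le_mul_of_nonneg_left hnorm hlam.le
      linarith
    have h3 := mul_le_mul_of_nonneg_left h2 (by positivity : 0 ≤ σ ^ 2 / t)
    have e1 : σ ^ 2 / t * ((r ⬝ᵥ r) / (2 * σ ^ 2) + lam * ∑ j, |x j|) =
        (r ⬝ᵥ r) / (2 * t) + lam * σ ^ 2 * (∑ j, |x j|) / t := by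
      field_simp
    have e2 : σ ^ 2 / t * ((r ⬝ᵥ r - 2 * t * (r ⬝ᵥ d) + t ^ 2 * (d ⬝ᵥ d)) / (2 * σ ^ 2) +
          lam * ((1 - t) * ∑ j, |x j| + t * ∑ j, |x' j|)) =
        (r ⬝ᵥ r) / (2 * t) - r ⬝ᵥ d + t / 2 * (d ⬝ᵥ d) + lam * σ ^ 2 * (∑ j, |x j|) / t
          + lam * σ ^ 2 * (∑ j, |x' j| - ∑ j, |x j|) := by
      field_simp
      ring
    rw [e1, e2] at h3
    linarith
  have hlim : Tendsto (fun t : ℝ => t / 2 * (d ⬝ᵥ d) +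
      lam * σ ^ 2 * (∑ j, |x' j| - ∑ j, |x j|)) (𝓝[>] 0)
      (𝓝 (0 / 2 * (d ⬝ᵥ d) + lam * σ ^ 2 * (∑ j, |x' j| - ∑ j, |x j|))) :=
    (Continuous.tendsto (by fun_prop) 0).mono_left nhdsWithin_le_nhds
  have := ge_of_tendsto hlim (by
    filter_upwards [Ioc_mem_nhdsGT (zero_lt_one (α := ℝ))] with t ht using key t ht.1 ht.2)
  simpa using this

theorem sum_abs_update (x : Fin N → ℝ) (j : Fin N) (c : ℝ) :
    ∑ k, |(x + c • Pi.single j 1 : Fin N → ℝ) k| - ∑ k, |x k| = |x j + c| - |x j| := by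
  rw [← Finset.sum_sub_distrib, Finset.sum_eq_single j]
  · simp
  · intro k _ hk
    simp [hk]
  · simp

/-- The stationarity condition for a coefficient of a LASSO estimate. -/
theorem IsEstimate.mul_dotProduct_column {σ lam : ℝ} (hσ : 0 < σ) (hlam : 0 < lam)
    {F : Matrix (Fin M) (Fin N) ℝ} {y : Fin M → ℝ} {x : Fin N → ℝ}
    (h : IsEstimate σ lam F y x) (j : Fin N) :
    x j * ((y - theta F x) ⬝ᵥ column F j) = lam * σ ^ 2 * |x j| := by
  have key : ∀ c : ℝ, c * ((y - theta F x) ⬝ᵥ column F j) ≤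
      lam * σ ^ 2 * (|x j + c| - |x j|) := by
    intro c
    have h1 := h.variational hσ hlam (x + c • Pi.single j 1)
    rw [sum_abs_update] at h1
    have : theta F (x + c • Pi.single j 1) - theta F x = c • column F j := by
      simp only [column, ← thetaLin_apply, map_add, map_smul]; abel
    rwa [this, dotProduct_smul, smul_eq_mul] at h1
  -- Doubling the coefficient and deleting it give the two opposite inequalities.
  have h1 := key (x j)
  have h2 := key (-x j)
  rw [add_neg_cancel, abs_zero] at h2
  rw [← two_mul, abs_mul, abs_two] at h1
  linarith

theorem IsEstimate.dotProduct_column {σ lam : ℝ} (hσ : 0 < σ) (hlam : 0 < lam)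
    {F : Matrix (Fin M) (Fin N) ℝ} {y : Fin M → ℝ} {x : Fin N → ℝ}
    (h : IsEstimate σ lam F y x) {j : Fin N} (hj : x j ≠ 0) :
    (y - theta F x) ⬝ᵥ column F j = lam * σ ^ 2 * (SignType.sign (x j) : ℝ) := by
  have h1 := h.mul_dotProduct_column hσ hlam j
  rw [← sign_mul_self] at h1
  apply mul_left_cancel₀ hj
  rw [h1]; ring

/-! ### Regularity of the fit. -/

/-- The LASSO fit is a firmly nonexpansive function of the data. -/
theorem IsEstimate.fit_firmly_nonexpansive {σ lam : ℝ} (hσ : 0 < σ) (hlam : 0 < lam)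
    {F : Matrix (Fin M) (Fin N) ℝ} {y₁ y₂ : Fin M → ℝ} {x₁ x₂ : Fin N → ℝ}
    (h₁ : IsEstimate σ lam F y₁ x₁) (h₂ : IsEstimate σ lam F y₂ x₂) :
    (theta F x₁ - theta F x₂) ⬝ᵥ (theta F x₁ - theta F x₂) ≤
      (y₁ - y₂) ⬝ᵥ (theta F x₁ - theta F x₂) := by
  have e1 := h₁.variational hσ hlam x₂
  have e2 := h₂.variational hσ hlam x₁
  simp only [dotProduct_sub, sub_dotProduct] at e1 e2 ⊢
  linarith

theorem IsEstimate.fit_eq {σ lam : ℝ} (hσ : 0 < σ) (hlam : 0 < lam)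
    {F : Matrix (Fin M) (Fin N) ℝ} {y : Fin M → ℝ} {x₁ x₂ : Fin N → ℝ}
    (h₁ : IsEstimate σ lam F y x₁) (h₂ : IsEstimate σ lam F y x₂) :
    theta F x₁ = theta F x₂ := by
  have := h₁.fit_firmly_nonexpansive hσ hlam h₂
  rw [sub_self, zero_dotProduct] at this
  have h0 := le_antisymm this (by simpa using dotProduct_star_self_nonneg (theta F x₁ - theta F x₂))
  exact sub_eq_zero.1 (dotProduct_self_eq_zero.1 h0)

theorem sq_norm_le_dotProduct_self (v : Fin M → ℝ) : ‖v‖ ^ 2 ≤ v ⬝ᵥ v := by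
  have h0 : 0 ≤ v ⬝ᵥ v := Finset.sum_nonneg fun i _ => mul_self_nonneg _
  have : ‖v‖ ≤ √(v ⬝ᵥ v) := by
    refine (pi_norm_le_iff_of_nonneg (Real.sqrt_nonneg _)).2 fun i => ?_
    rw [Real.norm_eq_abs]
    refine Real.abs_le_sqrt ?_
    rw [sq]
    exact Finset.single_le_sum (f := fun i => v i * v i) (fun i _ => mul_self_nonneg _)
      (Finset.mem_univ i)
  calc ‖v‖ ^ 2 ≤ √(v ⬝ᵥ v) ^ 2 := by gcongr
    _ = _ := Real.sq_sqrt h0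

theorem dotProduct_le_card_mul_norm (u v : Fin M → ℝ) : u ⬝ᵥ v ≤ M * (‖u‖ * ‖v‖) := by
  calc u ⬝ᵥ v ≤ ∑ _i : Fin M, ‖u‖ * ‖v‖ := by
        refine Finset.sum_le_sum fun i _ => ?_
        calc u i * v i ≤ |u i| * |v i| := by rw [← abs_mul]; exact le_abs_self _
          _ ≤ ‖u‖ * ‖v‖ := by
            gcongr
            · exact norm_le_pi_norm u i
            · exact norm_le_pi_norm v i
    _ = _ := by simp

/-- The constant `M` is the price of using the sup norm of `Fin M → ℝ`; only the existence of some
constant matters later. -/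
theorem lipschitzWith_fit {σ lam : ℝ} (hσ : 0 < σ) (hlam : 0 < lam)
    {F : Matrix (Fin M) (Fin N) ℝ} {xhat : (Fin M → ℝ) → Fin N → ℝ}
    (h : ∀ y, IsEstimate σ lam F y (xhat y)) :
    LipschitzWith M (fun y => theta F (xhat y)) := by
  refine LipschitzWith.of_dist_le_mul fun y₁ y₂ => ?_
  rw [dist_eq_norm, dist_eq_norm]
  set v := theta F (xhat y₁) - theta F (xhat y₂)
  have h1 : ‖v‖ ^ 2 ≤ M * (‖y₁ - y₂‖ * ‖v‖) :=
    (sq_norm_le_dotProduct_self v).trans <|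
      ((h y₁).fit_firmly_nonexpansive hσ hlam (h y₂)).trans (dotProduct_le_card_mul_norm _ _)
  rcases (norm_nonneg v).eq_or_lt' with h0 | h0
  · rw [h0]; positivity
  · have : ‖v‖ * ‖v‖ ≤ (M * ‖y₁ - y₂‖) * ‖v‖ := by linarith
    simpa using le_of_mul_le_mul_right this h0

/-! ### The divergence of the fit. -/

/-- If the LASSO estimate is unique, then the columns on its support are linearly independent. -/
theorem IsEstimate.linearIndependent_column {σ lam : ℝ} (hσ : 0 < σ) (hlam : 0 < lam)
    {F : Matrix (Fin M) (Fin N) ℝ} {y : Fin M → ℝ} {x : Fin N → ℝ}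
    (h : IsEstimate σ lam F y x) (huniq : ∀ x', IsEstimate σ lam F y x' → x' = x) :
    LinearIndependent ℝ (fun j : {j // x j ≠ 0} => column F j) := by
  rw [Fintype.linearIndependent_iff]
  intro g hg
  -- A relation among the active columns is a direction `v` that is supported on the support of `x`
  -- and leaves the fit unchanged.
  set v : Fin N → ℝ := fun j => if hj : x j ≠ 0 then g ⟨j, hj⟩ else 0 with hv
  have hvx : ∀ j, x j = 0 → v j = 0 := fun j hj => by simp [hv, hj]
  have hθ : theta F v = 0 := by
    rw [theta_eq_sum, ← hg, ← Fintype.sum_subtype_add_sum_subtype (fun j => x j ≠ 0)]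
    have h2 : ∑ i : {j // ¬ x j ≠ 0}, v i • column F i = 0 :=
      Finset.sum_eq_zero fun i _ => by rw [hvx _ (not_not.1 i.2), zero_smul]
    rw [h2, add_zero]
    refine Finset.sum_congr rfl fun i _ => ?_
    rw [hv]
    simp only [dif_pos i.2]
  -- For such `t` the moves by `± t • v` reverse no sign, so the two `ℓ₁` norms average to that of
  -- `x`. Neither is smaller, so both are equal to it and `x + t • v` is a second estimate unless `v
  -- = 0`.
  have hsmall : ∃ t : ℝ, 0 < t ∧ ∀ j, t * |v j| ≤ |x j| := by
    have : ∀ᶠ t : ℝ in 𝓝[>] 0, 0 < t ∧ ∀ j, t * |v j| ≤ |x j| := by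
      refine (eventually_mem_nhdsWithin).and (eventually_all.2 fun j => ?_)
      by_cases hj : x j = 0
      · simp [hvx j hj]
      · have : Tendsto (fun t : ℝ => t * |v j|) (𝓝[>] 0) (𝓝 (0 * |v j|)) :=
          (Continuous.tendsto (by fun_prop) 0).mono_left nhdsWithin_le_nhds
        rw [zero_mul] at this
        exact (this.eventually_lt_const (abs_pos.2 hj)).mono fun _ => le_of_lt
    exact this.exists
  obtain ⟨t, ht, htv⟩ := hsmall
  have hfit : ∀ c : ℝ, theta F (x + c • v) = theta F x := by
    intro c
    rw [← thetaLin_apply, map_add, map_smul, thetaLin_apply, thetaLin_apply, hθ, smul_zero,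
      add_zero]
  have hge : ∀ c : ℝ, ∑ j, |x j| ≤ ∑ j, |(x + c • v) j| := by
    intro c
    have := h.variational hσ hlam (x + c • v)
    rw [hfit, sub_self, dotProduct_zero] at this
    exact sub_nonneg.1 (nonneg_of_mul_nonneg_right this (by positivity))
  have hsum : ∑ j, |(x + t • v) j| + ∑ j, |(x + (-t) • v) j| = 2 * ∑ j, |x j| := by
    rw [← Finset.sum_add_distrib, Finset.mul_sum]
    refine Finset.sum_congr rfl fun j _ => ?_
    have := htv j
    rw [← abs_of_pos ht, ← abs_mul] at this
    simp only [Pi.add_apply, Pi.smul_apply, smul_eq_mul, neg_mul]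
    rcases abs_cases (x j) with hx | hx <;> rcases abs_cases (t * v j) with hy | hy <;>
    rcases abs_cases (x j + t * v j) with hz | hz <;>
    rcases abs_cases (x j + -(t * v j)) with hw | hw <;> linarith
  have hest : IsEstimate σ lam F y (x + t • v) := by
    intro x'
    refine (h x').trans (le_of_eq ?_)
    rw [objective, objective, hfit]
    have h1 := hge t
    have h2 := hge (-t)
    have : ∑ j, |(x + t • v) j| = ∑ j, |x j| := by linarith
    rw [this]
  have hzero : t • v = 0 := by simpa using huniq _ hest
  have hv0 : v = 0 := (smul_eq_zero.1 hzero).resolve_left ht.ne'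
  intro ⟨j, hj⟩
  have := congrFun hv0 j
  simpa [hv, hj] using this

/-- Existence of the orthogonal projection for the dot product. -/
theorem exists_dotProduct_projection (W : Submodule ℝ (Fin M → ℝ)) :
    ∃ P : (Fin M → ℝ) →ₗ[ℝ] (Fin M → ℝ), LinearMap.trace ℝ _ P = Module.finrank ℝ W ∧
      ∀ d, ∀ w ∈ W, (∀ u ∈ W, (d - w) ⬝ᵥ u = 0) → P d = w := by
  -- `Fin M → ℝ` carries the sup norm, so the projection is conjugated from Euclidean space.
  set e := WithLp.linearEquiv 2 ℝ (Fin M → ℝ) with he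
  set W' : Submodule ℝ (EuclideanSpace ℝ (Fin M)) := W.comap e.toLinearMap with hW'
  have hmem : ∀ u : Fin M → ℝ, e.symm u ∈ W' ↔ u ∈ W := fun u => Iff.rfl
  have hmem' : ∀ u : EuclideanSpace ℝ (Fin M), u ∈ W' ↔ e u ∈ W := fun u => Iff.rfl
  set P : (Fin M → ℝ) →ₗ[ℝ] (Fin M → ℝ) := e.conj W'.starProjection.toLinearMap with hP
  have hPa : ∀ d, P d = e (W'.starProjection (e.symm d)) := fun d => rfl
  have hPW : ∀ d, ∀ w ∈ W, (∀ u ∈ W, (d - w) ⬝ᵥ u = 0) → P d = w := by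
    intro d w hw hd
    rw [hPa, Submodule.eq_starProjection_of_mem_of_inner_eq_zero ((hmem w).2 hw),
      LinearEquiv.apply_symm_apply]
    intro u hu
    rw [EuclideanSpace.inner_eq_star_dotProduct]
    have := hd (e u) ((hmem' u).1 hu)
    rw [dotProduct_comm] at this
    simpa [he] using this
  refine ⟨P, LinearMap.IsProj.trace ⟨fun x => ?_, fun x hx => hPW x x hx fun u _ => ?_⟩, hPW⟩
  · rw [hPa]
    exact (hmem' _).1 (Submodule.starProjection_apply_mem _ _)
  · rw [sub_self, zero_dotProduct]

/-- A function that is differentiable almost everywhere has derivative `A` at almost every point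
where it agrees with an affine map with linear part `A`. -/
theorem ae_fderiv_eq_of_eq_affine {f : (Fin M → ℝ) → Fin M → ℝ} (hf : Continuous f)
    (hd : ∀ᵐ y, DifferentiableAt ℝ f y) (A : (Fin M → ℝ) →L[ℝ] (Fin M → ℝ)) (c : Fin M → ℝ) :
    ∀ᵐ y, f y = A y + c → fderiv ℝ f y = A := by
  set s : Set (Fin M → ℝ) := {y | f y = A y + c} ∩ {y | DifferentiableAt ℝ f y} with hs
  have hsm : MeasurableSet s :=
    (isClosed_eq hf (by fun_prop)).measurableSet.inter (measurableSet_of_differentiableAt ℝ f)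
  -- On `s` the function `f` differs from `A` by a constant, so the approximation error is zero, and
  -- it bounds `fderiv ℝ f - A` at almost every point of `s`.
  have happ : ApproximatesLinearOn f A s 0 := by
    intro x hx y hy
    rw [hx.1, hy.1, map_sub]
    simp
  have h := happ.norm_fderiv_sub_le volume hsm (fderiv ℝ f)
    fun x hx => hx.2.hasFDerivAt.hasFDerivWithinAt
  rw [ae_restrict_iff' hsm] at h
  filter_upwards [h, hd] with y hy hdy hfy
  have := hy ⟨hfy, hdy⟩
  exact sub_eq_zero.1 (nnnorm_eq_zero.1 (le_antisymm this zero_le))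

/-- For almost all data with a unique LASSO estimate, the divergence of the LASSO fit is the number
of nonzero coefficients. -/
theorem ae_trace_fderiv_fit {σ lam : ℝ} (hσ : 0 < σ) (hlam : 0 < lam)
    {F : Matrix (Fin M) (Fin N) ℝ}
    (huniq : ∀ᵐ y : Fin M → ℝ, ∃! x : Fin N → ℝ, IsEstimate σ lam F y x)
    {xhat : (Fin M → ℝ) → Fin N → ℝ} (h : ∀ y, IsEstimate σ lam F y (xhat y)) :
    ∀ᵐ y : Fin M → ℝ, LinearMap.trace ℝ _
      (fderiv ℝ (fun y => theta F (xhat y)) y).toLinearMap = hammingNorm (xhat y) := by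
  have hlip := lipschitzWith_fit hσ hlam h
  have hdiff : ∀ᵐ y : Fin M → ℝ, DifferentiableAt ℝ (fun y => theta F (xhat y)) y :=
    hlip.ae_differentiableAt
  set W : (Fin N → SignType) → Submodule ℝ (Fin M → ℝ) := fun s =>
    Submodule.span ℝ (Set.range fun j : {j // s j ≠ 0} => column F j) with hW
  choose P hPtr hP using fun s => exists_dotProduct_projection (W s)
  -- For two data vectors with sign pattern `s`, the residuals have the same inner products with the
  -- active columns, so their difference is orthogonal to `W s`, which contains both fits.
  have hrep : ∀ s : Fin N → SignType, ∃ c : Fin M → ℝ, ∀ y,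
      (∀ j, SignType.sign (xhat y j) = s j) → theta F (xhat y) = P s y + c := by
    intro s
    have hθW : ∀ y, (∀ j, SignType.sign (xhat y j) = s j) → theta F (xhat y) ∈ W s := by
      intro y hy
      rw [theta_eq_sum]
      refine Submodule.sum_mem _ fun j _ => ?_
      by_cases hj : s j = 0
      · rw [sign_eq_zero_iff.1 ((hy j).trans hj), zero_smul]
        exact Submodule.zero_mem _
      · exact Submodule.smul_mem _ _ (Submodule.subset_span ⟨⟨j, hj⟩, rfl⟩)
    by_cases hex : ∃ y, ∀ j, SignType.sign (xhat y j) = s j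
    · obtain ⟨y₀, hy₀⟩ := hex
      refine ⟨theta F (xhat y₀) - P s y₀, fun y hy => ?_⟩
      have : P s (y - y₀) = theta F (xhat y) - theta F (xhat y₀) := by
        refine hP s _ _ (Submodule.sub_mem _ (hθW y hy) (hθW y₀ hy₀)) fun u hu => ?_
        induction hu using Submodule.span_induction with
        | mem u hu =>
          obtain ⟨⟨j, hj⟩, rfl⟩ := hu
          have hne : ∀ y, (∀ j, SignType.sign (xhat y j) = s j) → xhat y j ≠ 0 :=
            fun y hy h0 => hj (by rw [← hy j, h0, sign_zero])
          have e1 := (h y).dotProduct_column hσ hlam (hne y hy)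
          have e2 := (h y₀).dotProduct_column hσ hlam (hne y₀ hy₀)
          rw [hy j] at e1
          rw [hy₀ j] at e2
          simp only [sub_dotProduct] at e1 e2 ⊢
          linarith
        | zero => exact dotProduct_zero _
        | add u v _ _ hu hv => rw [dotProduct_add, hu, hv, add_zero]
        | smul a u _ hu => rw [dotProduct_smul, hu, smul_zero]
      rw [map_sub] at this
      rw [eq_sub_iff_add_eq] at this
      rw [← this]; abel
    · exact ⟨0, fun y hy => (hex ⟨y, hy⟩).elim⟩
  choose c hc using hrep
  have hae : ∀ᵐ y : Fin M → ℝ, ∀ s, theta F (xhat y) = (P s).toContinuousLinearMap y + c s →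
      fderiv ℝ (fun y => theta F (xhat y)) y = (P s).toContinuousLinearMap :=
    ae_all_iff.2 fun s => ae_fderiv_eq_of_eq_affine hlip.continuous hdiff _ _
  filter_upwards [hae, huniq] with y hy hu
  set s : Fin N → SignType := fun j => SignType.sign (xhat y j) with hs
  rw [hy s (hc s y fun _ => rfl), LinearMap.coe_toContinuousLinearMap, hPtr]
  have hind := (h y).linearIndependent_column hσ hlam fun x' hx' => hu.unique hx' (h y)
  have hW' : W s = Submodule.span ℝ
      (Set.range fun j : {j // xhat y j ≠ 0} => column F j) := by
    have hiff : ∀ j, s j ≠ 0 ↔ xhat y j ≠ 0 := fun j => sign_eq_zero_iff.not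
    refine congrArg (Submodule.span ℝ) (Set.ext fun u => ⟨?_, ?_⟩)
    · rintro ⟨⟨j, hj⟩, rfl⟩
      exact ⟨⟨j, (hiff j).1 hj⟩, rfl⟩
    · rintro ⟨⟨j, hj⟩, rfl⟩
      exact ⟨⟨j, (hiff j).2 hj⟩, rfl⟩
  rw [hW', finrank_span_eq_card hind, Fintype.card_subtype, hammingNorm]

/-- Fréchet differentiability makes the one-variable derivatives the diagonal of the Jacobian. -/
theorem gdf_eq_trace {F : Matrix (Fin M) (Fin N) ℝ} {xhat : (Fin M → ℝ) → Fin N → ℝ}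
    {y : Fin M → ℝ} (hd : DifferentiableAt ℝ (fun y => theta F (xhat y)) y) :
    gdf F xhat y = 1 / (M : ℝ) * LinearMap.trace ℝ _
      (fderiv ℝ (fun y => theta F (xhat y)) y).toLinearMap := by
  rw [gdf, LinearMap.trace_eq_matrix_trace ℝ (Pi.basisFun ℝ (Fin M)), Matrix.trace]
  congr 1
  refine Finset.sum_congr rfl fun i _ => ?_
  have hu : HasDerivAt (fun t => Function.update y i t) (Pi.single i (1 : ℝ)) (y i) :=
    hasDerivAt_update y i (y i)
  have hd' : HasFDerivAt (fun y => theta F (xhat y)) (fderiv ℝ (fun y => theta F (xhat y)) y)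
      (Function.update y i (y i)) := by
    rw [Function.update_eq_self]; exact hd.hasFDerivAt
  have h1 := hasDerivAt_pi.1 (hd'.comp_hasDerivAt (y i) hu) i
  refine h1.deriv.trans ?_
  simp

/-! ### Stein's identity in one variable. -/

theorem hasDerivAt_gaussianPDFReal (m : ℝ) (v : ℝ≥0) (t : ℝ) :
    HasDerivAt (gaussianPDFReal m v) (-((t - m) / v) * gaussianPDFReal m v t) t := by
  have h1 : HasDerivAt (fun x : ℝ => -(x - m) ^ 2 / (2 * v)) (-((t - m) / v)) t := by
    have := (((hasDerivAt_id t).sub_const m).pow 2).neg.div_const (2 * (v : ℝ))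
    convert! this using 1
    simp
    ring
  have h2 := (h1.exp).const_mul (√(2 * Real.pi * v))⁻¹
  convert! h2 using 1
  rw [gaussianPDFReal]; ring

theorem tendsto_abs_sub_mul_gaussianPDFReal (m : ℝ) {v : ℝ≥0} (hv : v ≠ 0) (s : ℝ) :
    Tendsto (fun t => |t - m| ^ s * gaussianPDFReal m v t) (cocompact ℝ) (𝓝 0) := by
  have hv' : (0 : ℝ) < v := NNReal.coe_pos.2 (pos_iff_ne_zero.2 hv)
  have h := tendsto_rpow_abs_mul_exp_neg_mul_sq_cocompact (a := 1 / (2 * v)) (by positivity) s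
  have h1 := (h.comp (Homeomorph.subRight m).isClosedEmbedding.tendsto_cocompact).const_mul
    (√(2 * Real.pi * v))⁻¹
  rw [mul_zero] at h1
  refine h1.congr fun t => ?_
  simp only [Function.comp_apply, Homeomorph.coe_subRight, gaussianPDFReal]
  have : -(1 / (2 * (v : ℝ))) * (t - m) ^ 2 = -(t - m) ^ 2 / (2 * v) := by ring
  rw [this]; ring

/-- This removes the boundary terms in the integration by parts: `f` grows at most linearly. -/
theorem tendsto_mul_gaussianPDFReal_of_lipschitz (m : ℝ) {v : ℝ≥0} (hv : v ≠ 0) {f : ℝ → ℝ}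
    {C : ℝ≥0} (hf : LipschitzWith C f) :
    Tendsto (fun t => f t * gaussianPDFReal m v t) (cocompact ℝ) (𝓝 0) := by
  have h0 := (tendsto_abs_sub_mul_gaussianPDFReal m hv 0).const_mul |f m|
  have h1 := (tendsto_abs_sub_mul_gaussianPDFReal m hv 1).const_mul (C : ℝ)
  have h2 := h0.add h1
  simp only [mul_zero, add_zero] at h2
  refine squeeze_zero_norm (fun t => ?_) h2
  rw [norm_mul, Real.norm_of_nonneg (gaussianPDFReal_nonneg m v t), Real.rpow_zero,
    Real.rpow_one, one_mul, ← mul_assoc, ← add_mul]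
  refine mul_le_mul_of_nonneg_right ?_ (gaussianPDFReal_nonneg m v t)
  have := hf.dist_le_mul t m
  rw [Real.dist_eq, Real.dist_eq] at this
  have h3 := abs_sub_abs_le_abs_sub (f t) (f m)
  rw [Real.norm_eq_abs]
  linarith

theorem memLp_of_lipschitz_gaussianReal (m : ℝ) (v : ℝ≥0) {f : ℝ → ℝ} {C : ℝ≥0}
    (hf : LipschitzWith C f) : MemLp f 2 (gaussianReal m v) := by
  have h1 : MemLp (fun t => |f m| + C * |t - m|) 2 (gaussianReal m v) :=
    (memLp_const |f m|).add ((((memLp_id_gaussianReal' 2 ENNReal.ofNat_ne_top).sub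
      (memLp_const m)).norm).const_mul (C : ℝ))
  refine h1.mono hf.continuous.aestronglyMeasurable (ae_of_all _ fun t => ?_)
  have := hf.dist_le_mul t m
  rw [Real.dist_eq, Real.dist_eq] at this
  have h3 := abs_sub_abs_le_abs_sub (f t) (f m)
  rw [Real.norm_eq_abs, Real.norm_of_nonneg (by positivity)]
  linarith

theorem integrable_deriv_gaussianReal (m : ℝ) (v : ℝ≥0) {f : ℝ → ℝ} {C : ℝ≥0}
    (hf : LipschitzWith C f) : Integrable (deriv f) (gaussianReal m v) :=
  Integrable.of_bound (measurable_deriv f).aestronglyMeasurable C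
    (ae_of_all _ fun _ => norm_deriv_le_of_lipschitz hf)

theorem integrable_sub_mul_gaussianReal (m : ℝ) (v : ℝ≥0) {f : ℝ → ℝ} {C : ℝ≥0}
    (hf : LipschitzWith C f) : Integrable (fun t => (t - m) * f t) (gaussianReal m v) :=
  MemLp.integrable_mul ((memLp_id_gaussianReal' 2 ENNReal.ofNat_ne_top).sub (memLp_const m))
    (memLp_of_lipschitz_gaussianReal m v hf)

/-- Stein's identity for a Lipschitz function of a real Gaussian variable. -/
theorem integral_sub_mul_gaussianReal (m : ℝ) {v : ℝ≥0} (hv : v ≠ 0) {f : ℝ → ℝ} {C : ℝ≥0}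
    (hf : LipschitzWith C f) :
    ∫ t, (t - m) * f t ∂(gaussianReal m v) = v * ∫ t, deriv f t ∂(gaussianReal m v) := by
  have hv' : (0 : ℝ) < v := NNReal.coe_pos.2 (pos_iff_ne_zero.2 hv)
  set p := gaussianPDFReal m v with hp
  have hp' : deriv p = fun t => -((t - m) / v) * p t :=
    funext fun t => (hasDerivAt_gaussianPDFReal m v t).deriv
  have hpc : ContDiff ℝ 1 p := by
    rw [hp, gaussianPDFReal_def]; fun_prop
  have hden : ∀ {g : ℝ → ℝ}, Integrable g (gaussianReal m v) → Integrable (fun t => g t * p t) := by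
    intro g hg
    rw [gaussianReal_of_var_ne_zero m hv, integrable_withDensity_iff_integrable_smul'
      (measurable_gaussianPDF m v) (ae_of_all _ fun _ => gaussianPDF_lt_top)] at hg
    refine hg.congr (ae_of_all _ fun t => ?_)
    simp only [toReal_gaussianPDF, smul_eq_mul, mul_comm, hp]
  have i1 := hden (integrable_deriv_gaussianReal m v hf)
  have i2 : Integrable (fun t => f t * deriv p t) := by
    refine ((hden (integrable_sub_mul_gaussianReal m v hf)).const_mul (-(1 / (v : ℝ)))).congr
      (ae_of_all _ fun t => ?_)
    simp only [hp']; ring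
  -- A Lipschitz `f` need not be differentiable everywhere, but absolute continuity suffices to
  -- integrate by parts.
  have hparts : ∀ R : ℝ, ∫ t in (-R)..R, f t * deriv p t =
      f R * p R - f (-R) * p (-R) - ∫ t in (-R)..R, deriv f t * p t := fun R =>
    AbsolutelyContinuousOnInterval.integral_mul_deriv_eq_deriv_mul
      (hf.lipschitzOnWith.absolutelyContinuousOnInterval)
      (hpc.contDiffOn.absolutelyContinuousOnInterval)
  have hcc := tendsto_mul_gaussianPDFReal_of_lipschitz m hv hf
  have b1 : Tendsto (fun R => f R * p R) atTop (𝓝 0) := hcc.mono_left atTop_le_cocompact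
  have b2 : Tendsto (fun R => f (-R) * p (-R)) atTop (𝓝 0) :=
    (hcc.mono_left atBot_le_cocompact).comp tendsto_neg_atTop_atBot
  have l1 := intervalIntegral_tendsto_integral i2 tendsto_neg_atTop_atBot tendsto_id
  have l2 := intervalIntegral_tendsto_integral i1 tendsto_neg_atTop_atBot tendsto_id
  have l3 := (b1.sub b2).sub l2
  have heq := tendsto_nhds_unique (l1.congr hparts) l3
  rw [integral_gaussianReal_eq_integral_smul hv, integral_gaussianReal_eq_integral_smul hv]
  simp only [smul_eq_mul]
  have e1 : ∫ t, f t * deriv p t = -(1 / (v : ℝ)) * ∫ t, p t * ((t - m) * f t) := by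
    rw [← integral_const_mul]
    refine integral_congr_ae (ae_of_all _ fun t => ?_)
    simp only [hp']; ring
  have e2 : ∫ t, p t * deriv f t = ∫ t, deriv f t * p t := by simp only [mul_comm]
  rw [e1] at heq
  rw [← hp, e2]
  generalize ∫ t, p t * ((t - m) * f t) = I at heq ⊢
  field_simp at heq
  linarith

/-! ### The law of the data and Stein's identity in several variables. -/

instance (σ : ℝ) (m : Fin M → ℝ) : IsProbabilityMeasure (dataLaw σ m) := by
  unfold dataLaw; infer_instance

/-- Induction on the number of factors. It carries Lebesgue-almost-everywhere statements over to the
laws of the data and of the predictors. -/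
theorem pi_absolutelyContinuous {X : Type*} [MeasurableSpace X] :
    ∀ {n : ℕ} {μ ν : Fin n → Measure X} [∀ i, SigmaFinite (μ i)] [∀ i, SigmaFinite (ν i)],
      (∀ i, μ i ≪ ν i) → Measure.pi μ ≪ Measure.pi ν
  | 0, μ, ν, _, _, _ => by
    rw [Measure.pi_of_empty μ, Measure.pi_of_empty ν]
  | n + 1, μ, ν, _, _, h => by
    have h1 := (measurePreserving_piFinSuccAbove μ 0).symm
    have h2 := (measurePreserving_piFinSuccAbove ν 0).symm
    rw [← h1.map_eq, ← h2.map_eq]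
    exact ((h 0).prod (pi_absolutelyContinuous fun j => h (Fin.succAbove 0 j))).map h1.measurable

theorem dataLaw_absolutelyContinuous {σ : ℝ} (hσ : 0 < σ) (m : Fin M → ℝ) :
    dataLaw σ m ≪ volume :=
  pi_absolutelyContinuous fun i => gaussianReal_absolutelyContinuous (m i) (noiseVar_ne_zero hσ)

theorem gaussianPredictors_absolutelyContinuous (M N : ℕ) :
    gaussianPredictors M N ≪ volume :=
  pi_absolutelyContinuous fun _ => pi_absolutelyContinuous fun _ =>
    gaussianReal_absolutelyContinuous 0 one_ne_zero

theorem memLp_eval_dataLaw (σ : ℝ) (m : Fin M → ℝ) (i : Fin M) :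
    MemLp (fun y : Fin M → ℝ => y i) 2 (dataLaw σ m) :=
  (memLp_id_gaussianReal' 2 ENNReal.ofNat_ne_top).comp_measurePreserving
    (measurePreserving_eval (fun i => gaussianReal (m i) (noiseVar σ)) i)

theorem memLp_eval_sub_dataLaw (σ : ℝ) (m : Fin M → ℝ) (i : Fin M) (c : ℝ) :
    MemLp (fun y : Fin M → ℝ => y i - c) 2 (dataLaw σ m) :=
  (memLp_eval_dataLaw σ m i).sub (memLp_const c)

theorem memLp_of_lipschitz_dataLaw (σ : ℝ) (m : Fin M → ℝ) {f : (Fin M → ℝ) → ℝ} {C : ℝ≥0}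
    (hf : LipschitzWith C f) : MemLp f 2 (dataLaw σ m) := by
  have h1 : MemLp (fun y => |f m| + C * ∑ i, ‖y i - m i‖) 2 (dataLaw σ m) :=
    (memLp_const |f m|).add ((memLp_finsetSum _ fun i _ =>
      (memLp_eval_sub_dataLaw σ m i (m i)).norm).const_mul (C : ℝ))
  refine h1.mono hf.continuous.aestronglyMeasurable (ae_of_all _ fun y => ?_)
  have h2 := hf.dist_le_mul y m
  rw [Real.dist_eq, dist_eq_norm] at h2
  have h3 := abs_sub_abs_le_abs_sub (f y) (f m)
  have h4 : ‖y - m‖ ≤ ∑ i, ‖y i - m i‖ := by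
    refine (pi_norm_le_iff_of_nonneg (by positivity)).2 fun i => ?_
    exact Finset.single_le_sum (f := fun i => ‖y i - m i‖) (fun _ _ => norm_nonneg _)
      (Finset.mem_univ i)
  have h5 := mul_le_mul_of_nonneg_left h4 C.coe_nonneg
  rw [Real.norm_eq_abs, Real.norm_of_nonneg (by positivity)]
  linarith

theorem lipschitzWith_update (y : Fin M → ℝ) (i : Fin M) :
    LipschitzWith 1 (fun t => Function.update y i t) := by
  refine LipschitzWith.of_dist_le_mul fun s t => ?_
  rw [NNReal.coe_one, one_mul]
  refine (dist_pi_le_iff dist_nonneg).2 fun j => ?_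
  rcases eq_or_ne j i with rfl | hj
  · simp
  · simp [hj]

theorem integrable_partialDeriv_dataLaw (σ : ℝ) (m : Fin M → ℝ) {f : (Fin M → ℝ) → ℝ} {C : ℝ≥0}
    (hf : LipschitzWith C f) (i : Fin M) :
    Integrable (fun y => deriv (fun t => f (Function.update y i t)) (y i)) (dataLaw σ m) := by
  have hc : Continuous (Function.uncurry fun (y : Fin M → ℝ) (t : ℝ) =>
      f (Function.update y i t)) :=
    hf.continuous.comp (continuous_fst.update i continuous_snd)
  have hm : Measurable (fun y : Fin M → ℝ => deriv (fun t => f (Function.update y i t)) (y i)) :=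
    (measurable_deriv_with_param hc).comp (measurable_id.prodMk (measurable_pi_apply i))
  exact Integrable.of_bound hm.aestronglyMeasurable (C * 1 : ℝ≥0) (ae_of_all _ fun y =>
    norm_deriv_le_of_lipschitz (hf.comp (lipschitzWith_update y i)))

/-- Fubini with coordinate `i` innermost, so that the one-variable Stein identity applies on each
line. -/
theorem integral_dataLaw_eq_iterated {n : ℕ} (σ : ℝ) (m : Fin (n + 1) → ℝ) (i : Fin (n + 1))
    {g : (Fin (n + 1) → ℝ) → ℝ} (hg : Integrable g (dataLaw σ m)) :
    ∫ y, g y ∂(dataLaw σ m) = ∫ z, ∫ t, g (i.insertNth t z) ∂(gaussianReal (m i) (noiseVar σ))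
      ∂(Measure.pi fun j => gaussianReal (m (i.succAbove j)) (noiseVar σ)) := by
  have hmp := (measurePreserving_piFinSuccAbove
    (fun i => gaussianReal (m i) (noiseVar σ)) i).symm
  have hg' := (hmp.integrable_comp_emb (MeasurableEquiv.measurableEmbedding _)).2 hg
  rw [dataLaw, ← hmp.integral_comp']
  exact integral_prod_symm _ hg'

/-- Stein's identity for a Lipschitz function of independent Gaussian variables. -/
theorem integral_sub_mul_dataLaw {σ : ℝ} (hσ : 0 < σ) (m : Fin M → ℝ) {f : (Fin M → ℝ) → ℝ}
    {C : ℝ≥0} (hf : LipschitzWith C f) (i : Fin M) :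
    ∫ y, (y i - m i) * f y ∂(dataLaw σ m) =
      σ ^ 2 * ∫ y, deriv (fun t => f (Function.update y i t)) (y i) ∂(dataLaw σ m) := by
  obtain _ | n := M
  · exact i.elim0
  have i1 : Integrable (fun y => (y i - m i) * f y) (dataLaw σ m) :=
    (memLp_eval_sub_dataLaw σ m i (m i)).integrable_mul (memLp_of_lipschitz_dataLaw σ m hf)
  rw [integral_dataLaw_eq_iterated σ m i i1,
    integral_dataLaw_eq_iterated σ m i (integrable_partialDeriv_dataLaw σ m hf i),
    ← integral_const_mul]
  refine integral_congr_ae (ae_of_all _ fun z => ?_)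
  have hupd : ∀ s t : ℝ, Function.update (i.insertNth (α := fun _ => ℝ) s z) i t =
      i.insertNth (α := fun _ => ℝ) t z := fun s t => by simp
  have hl : LipschitzWith (C * 1) fun t => f (i.insertNth (α := fun _ => ℝ) t z) := by
    have := hf.comp (lipschitzWith_update (i.insertNth (α := fun _ => ℝ) 0 z) i)
    simpa only [Function.comp_def, hupd] using this
  simpa only [hupd, Fin.insertNth_apply_same, coe_noiseVar] using
    integral_sub_mul_gaussianReal (m i) (noiseVar_ne_zero hσ) hl

theorem covariance_eval_dataLaw {σ : ℝ} (hσ : 0 < σ) (m : Fin M → ℝ) {f : (Fin M → ℝ) → ℝ}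
    {C : ℝ≥0} (hf : LipschitzWith C f) (i : Fin M) :
    covariance (fun y => y i) f (dataLaw σ m) =
      σ ^ 2 * ∫ y, deriv (fun t => f (Function.update y i t)) (y i) ∂(dataLaw σ m) := by
  have hmean : ∫ y, y i ∂(dataLaw σ m) = m i := by
    have h1 := integral_map (μ := dataLaw σ m) (measurable_pi_apply i).aemeasurable
      (f := fun t : ℝ => t) aestronglyMeasurable_id
    rw [← h1, dataLaw, (measurePreserving_eval
      (fun i => gaussianReal (m i) (noiseVar σ)) i).map_eq, integral_id_gaussianReal]
  rw [← integral_sub_mul_dataLaw hσ m hf i, covariance_eq_sub (memLp_eval_dataLaw σ m i)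
    (memLp_of_lipschitz_dataLaw σ m hf), hmean, ← integral_const_mul, ← integral_sub]
  · refine integral_congr_ae (ae_of_all _ fun y => ?_)
    simp only [Pi.mul_apply]; ring
  · exact (memLp_eval_dataLaw σ m i).integrable_mul (memLp_of_lipschitz_dataLaw σ m hf)
  · exact ((memLp_of_lipschitz_dataLaw σ m hf).integrable one_le_two).const_mul _

/-! ### Training error, prediction error and the unbiasedness of the criteria. -/

theorem integral_sq_sub_gaussianReal (m t : ℝ) {v : ℝ≥0} (hv : v ≠ 0) :
    Integrable (fun z => (z - t) ^ 2) (gaussianReal m v) ∧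
      ∫ z, (z - t) ^ 2 ∂(gaussianReal m v) = v + (m - t) ^ 2 := by
  have hl : LipschitzWith 1 fun z : ℝ => (z - m) + 2 * (m - t) := by
    refine LipschitzWith.of_dist_le_mul fun a b => ?_
    simp [Real.dist_eq]
  have hS := integral_sub_mul_gaussianReal m hv hl
  have hI := integrable_sub_mul_gaussianReal m v hl
  have hd : deriv (fun z : ℝ => (z - m) + 2 * (m - t)) = fun _ => 1 := by
    funext z; simp
  have he : (fun z : ℝ => (z - t) ^ 2) =
      fun z => (z - m) * ((z - m) + 2 * (m - t)) + (m - t) ^ 2 := by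
    funext z; ring
  rw [he]
  refine ⟨hI.add (integrable_const _), ?_⟩
  rw [integral_add hI (integrable_const _), hS, hd]
  simp

theorem errIn_eq {σ : ℝ} (hσ : 0 < σ) (hM : 0 < M) (F : Matrix (Fin M) (Fin N) ℝ)
    (m : Fin M → ℝ) (x : Fin N → ℝ) :
    errIn σ F m x = Real.log √(2 * Real.pi * σ ^ 2) + 1 / 2 +
      1 / (2 * σ ^ 2 * M) * ∑ i, (theta F x i - m i) ^ 2 := by
  have hM' : (M : ℝ) ≠ 0 := by positivity
  have h : ∀ i, ∫ z, Real.log (gaussianPDFReal (theta F x i) (noiseVar σ) z)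
      ∂(gaussianReal (m i) (noiseVar σ)) =
      -Real.log √(2 * Real.pi * σ ^ 2) - (σ ^ 2 + (theta F x i - m i) ^ 2) / (2 * σ ^ 2) := by
    intro i
    obtain ⟨hI, hE⟩ := integral_sq_sub_gaussianReal (m i) (theta F x i) (noiseVar_ne_zero hσ)
    simp only [log_gaussianPDFReal hσ]
    rw [integral_sub (integrable_const _) (hI.div_const _), integral_div, hE, coe_noiseVar]
    simp only [integral_const, probReal_univ, one_smul]
    ring
  simp only [errIn, h, Finset.sum_sub_distrib, ← Finset.sum_div, Finset.sum_add_distrib,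
    Finset.sum_const, Finset.card_univ, Fintype.card_fin, nsmul_eq_mul]
  field_simp
  ring

theorem errTrain_eq {σ : ℝ} (hσ : 0 < σ) (hM : 0 < M) (F : Matrix (Fin M) (Fin N) ℝ)
    (y : Fin M → ℝ) (x : Fin N → ℝ) :
    errTrain σ F y x = Real.log √(2 * Real.pi * σ ^ 2) +
      1 / (2 * σ ^ 2 * M) * ∑ i, (y i - theta F x i) ^ 2 := by
  have hM' : (M : ℝ) ≠ 0 := by positivity
  rw [errTrain, logLik_eq hσ]
  field_simp
  ring

/-- With `a = y i - m i` and `b = f y - m i` this is the mean of `b² = (a - b)² - a² + 2ab`; the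
cross term is the covariance, since `a` has mean zero. -/
theorem integral_sq_sub_sub_sq_dataLaw {σ : ℝ} (hσ : 0 < σ) (m : Fin M → ℝ)
    {f : (Fin M → ℝ) → ℝ} {C : ℝ≥0} (hf : LipschitzWith C f) (i : Fin M) :
    ∫ y, (f y - m i) ^ 2 ∂(dataLaw σ m) =
      ∫ y, (y i - f y) ^ 2 ∂(dataLaw σ m) - σ ^ 2 +
        2 * covariance (fun y => y i) f (dataLaw σ m) := by
  have hF := memLp_of_lipschitz_dataLaw σ m hf
  have hY := memLp_eval_sub_dataLaw σ m i (m i)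
  have hl : LipschitzWith 1 fun y : Fin M → ℝ => y i - m i := by
    refine LipschitzWith.of_dist_le_mul fun a b => ?_
    rw [dist_sub_right, NNReal.coe_one, one_mul]
    exact dist_le_pi_dist a b i
  have h1 := integral_sub_mul_dataLaw hσ m hl i
  have h2 := integral_sub_mul_dataLaw hσ m hf i
  have h3 := integral_sub_mul_dataLaw hσ m (LipschitzWith.const (1 : ℝ)) i
  have hone : ∀ y : Fin M → ℝ,
      deriv (fun t => (Function.update y i t) i - m i) (y i) = 1 := fun y => by simp
  simp only [hone, deriv_const, integral_const, probReal_univ, smul_eq_mul, mul_one,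
    mul_zero] at h1 h3
  rw [covariance_eval_dataLaw hσ m hf, ← h2]
  have i1 : Integrable (fun y => (y i - f y) ^ 2) (dataLaw σ m) :=
    ((memLp_eval_dataLaw σ m i).sub hF).integrable_sq
  have i2 : Integrable (fun y => (y i - m i) * (y i - m i)) (dataLaw σ m) :=
    hY.integrable_mul hY
  have i3 : Integrable (fun y => (y i - m i) * f y) (dataLaw σ m) := hY.integrable_mul hF
  have i4 : Integrable (fun y : Fin M → ℝ => y i - m i) (dataLaw σ m) := hY.integrable one_le_two
  have he : (fun y : Fin M → ℝ => (f y - m i) ^ 2) = fun y => (y i - f y) ^ 2 -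
      (y i - m i) * (y i - m i) + 2 * ((y i - m i) * f y) - 2 * m i * (y i - m i) := by
    funext y; ring
  have i5 : Integrable (fun y => (y i - f y) ^ 2 - (y i - m i) * (y i - m i)) (dataLaw σ m) :=
    i1.sub i2
  have i6 : Integrable (fun y => (y i - f y) ^ 2 - (y i - m i) * (y i - m i) +
      2 * ((y i - m i) * f y)) (dataLaw σ m) := i5.add (i3.const_mul 2)
  rw [he, integral_sub i6 (i4.const_mul _),
    integral_add i5 (i3.const_mul 2), integral_sub i1 i2, integral_const_mul,
    integral_const_mul, h1, h3]
  ring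

/-- The LASSO estimate for a fixed predictor matrix with almost surely unique estimates. -/
theorem unbiased_of_ae_unique (hM : 0 < M) {σ lam : ℝ} (hσ : 0 < σ) (hlam : 0 < lam)
    {F : Matrix (Fin M) (Fin N) ℝ}
    (huniq : ∀ᵐ y : Fin M → ℝ, ∃! x : Fin N → ℝ, IsEstimate σ lam F y x)
    (m : Fin M → ℝ) {xhat : (Fin M → ℝ) → Fin N → ℝ} (h : ∀ y, IsEstimate σ lam F y (xhat y)) :
    (∀ i, MemLp (fun y => theta F (xhat y) i) 2 (dataLaw σ m)) ∧
    IsUnbiased (dataLaw σ m) (fun y => paramRatio M (xhat y)) (fun _ => covPenalty σ F m xhat) ∧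
    (∀ᵐ y ∂(dataLaw σ m), DifferentiableAt ℝ (fun y' => theta F (xhat y')) y ∧
      gdf F xhat y = paramRatio M (xhat y)) ∧
    (∀ᵐ y ∂(dataLaw σ m), Cp σ F xhat y = σ ^ 2 * AIC σ F xhat y) ∧
    IsUnbiased (dataLaw σ m) (Cp σ F xhat) (fun y => 2 * σ ^ 2 * errIn σ F m (xhat y)) ∧
    IsUnbiased (dataLaw σ m) (AIC σ F xhat) (fun y => 2 * errIn σ F m (xhat y)) := by
  have hM' : (M : ℝ) ≠ 0 := by positivity
  have hlip := lipschitzWith_fit hσ hlam h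
  have hlipi : ∀ i, LipschitzWith M fun y => theta F (xhat y) i := fun i =>
    LipschitzWith.of_dist_le_mul fun a b =>
      (dist_le_pi_dist _ _ i).trans (hlip.dist_le_mul a b)
  have hLp := fun i => memLp_of_lipschitz_dataLaw σ m (hlipi i)
  have hac := dataLaw_absolutelyContinuous hσ m
  have hdiff : ∀ᵐ y : Fin M → ℝ, DifferentiableAt ℝ (fun y => theta F (xhat y)) y :=
    hlip.ae_differentiableAt
  have hdof : ∀ᵐ y ∂(dataLaw σ m), DifferentiableAt ℝ (fun y' => theta F (xhat y')) y ∧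
      gdf F xhat y = paramRatio M (xhat y) := by
    filter_upwards [hac.ae_le hdiff, hac.ae_le (ae_trace_fderiv_fit hσ hlam huniq h)]
      with y hd htr
    refine ⟨hd, ?_⟩
    rw [gdf_eq_trace hd, htr, paramRatio, one_div_mul_eq_div]
  have hgdf_ae : gdf F xhat =ᵐ[dataLaw σ m] fun y => paramRatio M (xhat y) :=
    hdof.mono fun y hy => hy.2
  have hDint := fun i => integrable_partialDeriv_dataLaw σ m (hlipi i) i
  have hgdf_int : Integrable (gdf F xhat) (dataLaw σ m) :=
    (integrable_finsetSum _ fun i _ => hDint i).const_mul _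
  have hgdf_E : ∫ y, gdf F xhat y ∂(dataLaw σ m) = covPenalty σ F m xhat := by
    simp only [gdf, covPenalty, covariance_eval_dataLaw hσ m (hlipi _)]
    rw [integral_const_mul, integral_finsetSum _ fun i _ => hDint i, ← Finset.mul_sum]
    field_simp
  -- The selection `xhat` is not assumed measurable; measurability of `‖x̂‖₀` up to a null set is
  -- inherited from `gdf`.
  have hpar_int : Integrable (fun y => paramRatio M (xhat y)) (dataLaw σ m) :=
    hgdf_int.congr hgdf_ae
  have hpar_E : ∫ y, paramRatio M (xhat y) ∂(dataLaw σ m) = covPenalty σ F m xhat := by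
    rw [← hgdf_E]; exact (integral_congr_ae hgdf_ae).symm
  have hCpAIC : Cp σ F xhat =ᵐ[dataLaw σ m] fun y => σ ^ 2 * AIC σ F xhat y := by
    filter_upwards [hdof] with y hy
    rw [Cp, AIC, hy.2]; ring
  have hres : ∀ i, Integrable (fun y => (y i - theta F (xhat y) i) ^ 2) (dataLaw σ m) :=
    fun i => ((memLp_eval_dataLaw σ m i).sub (hLp i)).integrable_sq
  have hfit : ∀ i, Integrable (fun y => (theta F (xhat y) i - m i) ^ 2) (dataLaw σ m) :=
    fun i => ((hLp i).sub (memLp_const (m i))).integrable_sq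
  have htrain_int : Integrable (fun y => errTrain σ F y (xhat y)) (dataLaw σ m) := by
    simp only [errTrain_eq hσ hM]
    exact (integrable_const _).add ((integrable_finsetSum _ fun i _ => hres i).const_mul _)
  have hin_int : Integrable (fun y => errIn σ F m (xhat y)) (dataLaw σ m) := by
    simp only [errIn_eq hσ hM]
    exact (integrable_const _).add ((integrable_finsetSum _ fun i _ => hfit i).const_mul _)
  -- The `1 / 2` in `errIn_eq`, due to the variance of the new observation, cancels the `- σ ^ 2` of
  -- `integral_sq_sub_sub_sq_dataLaw`.
  have hE : ∫ y, errIn σ F m (xhat y) ∂(dataLaw σ m) =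
      ∫ y, errTrain σ F y (xhat y) ∂(dataLaw σ m) + covPenalty σ F m xhat := by
    simp only [errTrain_eq hσ hM, errIn_eq hσ hM]
    rw [integral_add (integrable_const _) ((integrable_finsetSum _ fun i _ => hfit i).const_mul _),
      integral_add (integrable_const _) ((integrable_finsetSum _ fun i _ => hres i).const_mul _),
      integral_const_mul, integral_const_mul, integral_finsetSum _ fun i _ => hfit i,
      integral_finsetSum _ fun i _ => hres i]
    simp only [integral_sq_sub_sub_sq_dataLaw hσ m (hlipi _), Finset.sum_add_distrib,
      Finset.sum_sub_distrib, ← Finset.mul_sum, integral_const, probReal_univ, one_smul,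
      Finset.sum_const, Finset.card_univ, Fintype.card_fin, nsmul_eq_mul, covPenalty]
    field_simp
    ring
  have hAIC_int : Integrable (AIC σ F xhat) (dataLaw σ m) :=
    (htrain_int.add hpar_int).const_mul 2
  have hAIC_E : ∫ y, AIC σ F xhat y ∂(dataLaw σ m) =
      2 * ∫ y, errIn σ F m (xhat y) ∂(dataLaw σ m) := by
    simp only [AIC]
    rw [integral_const_mul, integral_add htrain_int hpar_int, hpar_E, hE]
  refine ⟨hLp, ⟨hpar_int, integrable_const _, ?_⟩, hdof, hCpAIC,
    ⟨(hAIC_int.const_mul _).congr hCpAIC.symm, hin_int.const_mul _, ?_⟩,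
    ⟨hAIC_int, hin_int.const_mul _, ?_⟩⟩
  · rw [hpar_E, integral_const, probReal_univ, one_smul]
  · rw [integral_congr_ae hCpAIC, integral_const_mul, integral_const_mul, hAIC_E]
    ring
  · rw [integral_const_mul, hAIC_E]

/-! ### Existence, and uniqueness for Gaussian predictors. -/

/-- The penalty alone drives the continuous objective to `-∞` at infinity. -/
theorem exists_isEstimate {σ lam : ℝ} (hσ : 0 < σ) (hlam : 0 < lam)
    (F : Matrix (Fin M) (Fin N) ℝ) (y : Fin M → ℝ) : ∃ x, IsEstimate σ lam F y x := by
  have hθ : Continuous (theta F) := by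
    have := (thetaLin F).continuous_of_finiteDimensional
    rwa [show (⇑(thetaLin F)) = theta F from funext (thetaLin_apply F)] at this
  have hc : Continuous (objective σ lam F y) := by
    rw [show objective σ lam F y = _ from funext (objective_eq hσ lam F y)]
    simp only [dotProduct]
    fun_prop
  refine hc.exists_forall_ge ?_
  have hlim : Tendsto (fun x : Fin N → ℝ => -(M * Real.log √(2 * Real.pi * σ ^ 2)) +
      -lam * ‖x‖) (cocompact _) atBot :=
    tendsto_atBot_add_const_left _ _
      ((tendsto_norm_cocompact_atTop (E := Fin N → ℝ)).const_mul_atTop_of_neg (neg_lt_zero.2 hlam))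
  refine tendsto_atBot_mono (fun x => ?_) hlim
  rw [objective_eq hσ]
  have h1 : 0 ≤ ((y - theta F x) ⬝ᵥ (y - theta F x)) / (2 * σ ^ 2) :=
    div_nonneg (Finset.sum_nonneg fun i _ => mul_self_nonneg _) (by positivity)
  have h2 : ‖x‖ ≤ ∑ j, |x j| :=
    (pi_norm_le_iff_of_nonneg (by positivity)).2 fun j =>
      Finset.single_le_sum (f := fun j => |x j|) (fun _ _ => abs_nonneg _) (Finset.mem_univ j)
  have h3 := mul_le_mul_of_nonneg_left h2 hlam.le
  linarith

/-- For almost every matrix, a column is not an affine combination of at most `M` rescaled other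
columns. -/
theorem ae_column_notMem_affine_combination (T : Finset (Fin N)) (hT : T.card ≤ M) {j : Fin N}
    (hj : j ∉ T) (s : Fin N → ℝ) :
    ∀ᵐ F : Fin M → Fin N → ℝ, ¬ ∃ c : Fin N → ℝ, ∑ i ∈ T, c i = 1 ∧
      ∀ k, ∑ i ∈ T, c i * (s i * F k i) = F k j := by
  set K : Set ((Fin M → Fin N → ℝ) × (Fin N → ℝ)) :=
    {p | ∑ i ∈ T, p.2 i = 1 ∧ ∀ k, ∑ i ∈ T, p.2 i * (s i * p.1 k i) = p.1 k j} with hK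
  have hKc : IsClosed K := by
    have h1 : IsClosed {p : (Fin M → Fin N → ℝ) × (Fin N → ℝ) | ∑ i ∈ T, p.2 i = 1} :=
      isClosed_eq (by fun_prop) continuous_const
    have h2 : IsClosed (⋂ k, {p : (Fin M → Fin N → ℝ) × (Fin N → ℝ) |
        ∑ i ∈ T, p.2 i * (s i * p.1 k i) = p.1 k j}) :=
      isClosed_iInter fun k => isClosed_eq (by fun_prop) (by fun_prop)
    convert! h1.inter h2 using 1
    ext p
    simp [hK]
  -- A closed set in finite dimension is σ-compact, and so is its projection.
  have hmeas : MeasurableSet (Prod.fst '' K) := by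
    obtain ⟨A, hA, hU⟩ :=
      (isSigmaCompact_univ.of_isClosed_subset hKc (Set.subset_univ _)).image continuous_fst
    rw [← hU]
    exact MeasurableSet.iUnion fun n => (hA n).measurableSet
  -- `L` perturbs column `j` only, so it is enough that, for each fixed `F`, almost every
  -- perturbation of that column avoids the bad set.
  set L : (Fin M → ℝ) →ₗ[ℝ] (Fin M → Fin N → ℝ) :=
    LinearMap.pi fun k => (LinearMap.single ℝ (fun _ : Fin N => ℝ) j) ∘ₗ LinearMap.proj k with hL
  have hLj : ∀ v k, L v k j = v k := fun v k => by simp [hL]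
  have hLi : ∀ v k i, i ≠ j → L v k i = 0 := fun v k i hi => by simp [hL, hi]
  have hae : ∀ᵐ F : Fin M → Fin N → ℝ, F ∈ (Prod.fst '' K)ᶜ := by
    refine ae_mem_of_ae_add_linearMap_mem L volume volume hmeas.compl fun F => ?_
    -- The perturbation `v` is bad only if it lies in the affine span of the points `p i`, which has
    -- dimension below `M`.
    set p : Fin N → Fin M → ℝ := fun i k => s i * F k i - F k j with hp
    have hne : affineSpan ℝ (p '' T) ≠ ⊤ := by
      intro htop
      have hdir := congrArg AffineSubspace.direction htop
      rw [direction_affineSpan, AffineSubspace.direction_top] at hdir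
      rcases Nat.eq_zero_or_eq_succ_pred T.card with h0 | hn
      · rw [Finset.card_eq_zero.1 h0] at htop
        simp at htop
      · have := finrank_vectorSpan_image_finset_le ℝ p T hn
        rw [Finset.coe_image, hdir, finrank_top, Module.finrank_fin_fun] at this
        omega
    have hnull := Measure.addHaar_affineSubspace (volume : Measure (Fin M → ℝ)) _ hne
    rw [measure_eq_zero_iff_ae_notMem] at hnull
    filter_upwards [hnull] with v hv hmem
    obtain ⟨⟨F', c⟩, ⟨hc1, hc2⟩, hF'⟩ := hmem
    simp only at hc1 hc2 hF'
    apply hv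
    have hcomb : v = ∑ i ∈ T, c i • p i := by
      ext k
      have h1 := hc2 k
      rw [hF'] at h1
      have h2 : ∑ i ∈ T, c i * (s i * (F + L v) k i) = ∑ i ∈ T, c i * (s i * F k i) :=
        Finset.sum_congr rfl fun i hi => by
          rw [Pi.add_apply, Pi.add_apply, hLi v k i (ne_of_mem_of_not_mem hi hj), add_zero]
      rw [h2, Pi.add_apply, Pi.add_apply, hLj] at h1
      simp only [Finset.sum_apply, Pi.smul_apply, hp, smul_eq_mul, mul_sub,
        Finset.sum_sub_distrib, ← Finset.sum_mul, hc1]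
      linarith
    rw [hcomb, ← T.affineCombination_eq_linear_combination p c hc1]
    exact affineCombination_mem_affineSpan_image hc1 (fun i hi hi' => (hi' hi).elim) p
  filter_upwards [hae] with F hF hex
  obtain ⟨c, hc⟩ := hex
  exact hF ⟨(F, c), hc, rfl⟩

/-- If the columns are in general position, then the LASSO estimate is unique. -/
theorem IsEstimate.unique_of_generalPosition {σ lam : ℝ} (hσ : 0 < σ) (hlam : 0 < lam)
    {F : Matrix (Fin M) (Fin N) ℝ}
    (hF : ∀ T : Finset (Fin N), T.card ≤ M → ∀ j ∉ T, ∀ s : Fin N → SignType,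
      ¬ ∃ c : Fin N → ℝ, ∑ i ∈ T, c i = 1 ∧ ∀ k, ∑ i ∈ T, c i * ((s i : ℝ) * F k i) = F k j)
    {y : Fin M → ℝ} {x₁ x₂ : Fin N → ℝ} (h₁ : IsEstimate σ lam F y x₁)
    (h₂ : IsEstimate σ lam F y x₂) : x₁ = x₂ := by
  classical
  by_contra hne
  have hN : (√(N : ℝ)) ≠ 0 := by
    obtain ⟨j, -⟩ := Function.ne_iff.1 hne
    have : 0 < N := j.pos
    positivity
  have hcol : ∀ j k, column F j k = F k j / √(N : ℝ) := fun j k => by simp [column, theta]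
  have hfit := h₁.fit_eq hσ hlam h₂
  set r := y - theta F x₁ with hr
  have hκ : 0 < lam * σ ^ 2 := by positivity
  -- On the union of the supports, `s` is the sign seen by the common residual, whichever estimate
  -- supplies it.
  set s : Fin N → SignType := fun j =>
    if x₁ j ≠ 0 then SignType.sign (x₁ j) else SignType.sign (x₂ j) with hs
  have hs0 : ∀ j, x₁ j ≠ 0 ∨ x₂ j ≠ 0 → s j ≠ 0 := by
    intro j hj
    by_cases h : x₁ j = 0
    · simpa [hs, h] using hj
    · simp [hs, h]
  have hss : ∀ j, s j ≠ 0 → (s j : ℝ) * (s j : ℝ) = 1 := by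
    intro j hj
    generalize s j = u at hj
    cases u <;> simp at hj ⊢
  have hrs : ∀ j, r ⬝ᵥ column F j = lam * σ ^ 2 * (s j : ℝ) ∨ s j = 0 := by
    intro j
    by_cases h : x₁ j = 0
    · by_cases h' : x₂ j = 0
      · right; simp [hs, h, h']
      · left
        have := h₂.dotProduct_column hσ hlam h'
        rw [← hfit] at this
        rwa [show s j = SignType.sign (x₂ j) by simp [hs, h]]
    · left
      rw [show s j = SignType.sign (x₁ j) by simp [hs, h]]
      exact h₁.dotProduct_column hσ hlam h
  set B : {j // s j ≠ 0} → Fin M → ℝ := fun j => (s j : ℝ) • column F j with hB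
  have hrB : ∀ j, r ⬝ᵥ B j = lam * σ ^ 2 := fun j => by
    rw [hB, dotProduct_smul, (hrs j).resolve_right j.2, smul_eq_mul, mul_left_comm, hss j j.2,
      mul_one]
  obtain ⟨κ, a, ha, hspan, hind⟩ := exists_linearIndependent' ℝ B
  have : Finite κ := Finite.of_injective a ha
  have := Fintype.ofFinite κ
  have hcard : Fintype.card κ ≤ M := by
    simpa using hind.fintype_card_le_finrank
  -- Otherwise all the signed active columns are independent, and equality of the fits forces `x₁ =
  -- x₂`.
  have hsurj : ¬ Function.Surjective a := by
    intro hsurj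
    have hBind : LinearIndependent ℝ B :=
      (linearIndependent_equiv (Equiv.ofBijective a ⟨ha, hsurj⟩)).1 hind
    rw [Fintype.linearIndependent_iff] at hBind
    apply hne
    have hsum : ∑ j : {j // s j ≠ 0}, ((x₁ j - x₂ j) * (s j : ℝ)) • B j = 0 := by
      have h1 : ∑ j, (x₁ j - x₂ j) • column F j = 0 := by
        simp only [sub_smul, Finset.sum_sub_distrib, ← theta_eq_sum, hfit, sub_self]
      rw [← h1, ← Fintype.sum_subtype_add_sum_subtype (fun j => s j ≠ 0)]
      have h2 : ∑ i : {j // ¬ s j ≠ 0}, (x₁ i - x₂ i) • column F i = 0 :=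
        Finset.sum_eq_zero fun i _ => by
          have hi : ¬ (x₁ i ≠ 0 ∨ x₂ i ≠ 0) := fun h => i.2 (hs0 i h)
          push Not at hi
          rw [hi.1, hi.2, sub_self, zero_smul]
      rw [h2, add_zero]
      refine Finset.sum_congr rfl fun j _ => ?_
      rw [hB, smul_smul, mul_assoc, hss j j.2, mul_one]
    have hz := hBind _ hsum
    ext j
    by_cases hj : x₁ j ≠ 0 ∨ x₂ j ≠ 0
    · have h3 := hz ⟨j, hs0 j hj⟩
      have h4 : (s j : ℝ) ≠ 0 := left_ne_zero_of_mul_eq_one (hss j (hs0 j hj))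
      exact sub_eq_zero.1 ((mul_eq_zero.1 h3).resolve_right h4)
    · push Not at hj
      rw [hj.1, hj.2]
  have hex : ∃ j, ∀ k, a k ≠ j := by
    simpa [Function.Surjective] using hsurj
  obtain ⟨j, hj⟩ := hex
  have hmem : B j ∈ Submodule.span ℝ (Set.range (B ∘ a)) := by
    rw [hspan]; exact Submodule.subset_span ⟨j, rfl⟩
  obtain ⟨c, hc⟩ := (Submodule.mem_span_range_iff_exists_fun ℝ).1 hmem
  -- Pairing with `r` takes the same nonzero value on every `B j`, so the linear combination is an
  -- affine one.
  have hcsum : ∑ k, c k = 1 := by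
    have h1 := congrArg (fun v => r ⬝ᵥ v) hc
    simp only [dotProduct_sum, dotProduct_smul, Function.comp_apply, hrB, smul_eq_mul,
      ← Finset.sum_mul] at h1
    exact mul_right_cancel₀ hκ.ne' (h1.trans (one_mul _).symm)
  set b : κ ↪ Fin N := ⟨fun k => a k, Subtype.val_injective.comp ha⟩ with hb
  -- Multiplying the relation by `s j`, whose square is `1`, removes the sign of column `j` and puts
  -- `s j * s i` on the others.
  refine hF (Finset.univ.map b) (by simpa using hcard) j ?_ (fun i => s j * s i)
    ⟨Function.extend b c 0, ?_, fun k => ?_⟩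
  · simp only [Finset.mem_map, Finset.mem_univ, true_and, not_exists]
    exact fun k hk => hj k (Subtype.ext hk)
  · rw [Finset.sum_map]
    simpa only [b.injective.extend_apply] using hcsum
  · rw [Finset.sum_map]
    simp only [b.injective.extend_apply]
    have h1 := congrFun hc k
    simp only [Finset.sum_apply, Pi.smul_apply, Function.comp_apply, hB, hcol, smul_eq_mul] at h1
    have h2 : ∑ i, c i * ((s (a i) : ℝ) * F k (a i)) = s j * F k j := by
      have h3 := congrArg (· * √(N : ℝ)) h1
      simp only [Finset.sum_mul] at h3
      convert! h3 using 1
      · refine Finset.sum_congr rfl fun i _ => ?_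
        field_simp
      · field_simp
    calc ∑ i, c i * (((s j * s (b i) : SignType) : ℝ) * F k (b i))
        = s j * ∑ i, c i * ((s (a i) : ℝ) * F k (a i)) := by
          rw [Finset.mul_sum]
          refine Finset.sum_congr rfl fun i _ => ?_
          rw [SignType.coe_mul]
          simp only [hb, Function.Embedding.coeFn_mk]
          ring
      _ = F k j := by rw [h2, ← mul_assoc, hss j j.2, one_mul]

/-- The LASSO estimate exists and is unique for almost every Gaussian predictor matrix. -/
theorem ae_existsUnique_isEstimate (M N : ℕ) {σ lam : ℝ} (hσ : 0 < σ) (hlam : 0 < lam) :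
    ∀ᵐ F ∂(gaussianPredictors M N), ∀ y : Fin M → ℝ,
      ∃! x : Fin N → ℝ, IsEstimate σ lam (Matrix.of F) y x := by
  have hae : ∀ᵐ F : Fin M → Fin N → ℝ, ∀ (T : Finset (Fin N)) (j : Fin N)
      (s : Fin N → SignType), T.card ≤ M → j ∉ T → ¬ ∃ c : Fin N → ℝ, ∑ i ∈ T, c i = 1 ∧
        ∀ k, ∑ i ∈ T, c i * ((s i : ℝ) * F k i) = F k j := by
    simp only [ae_all_iff, eventually_imp_distrib_left]
    exact fun T j s hT hj => ae_column_notMem_affine_combination T hT hj fun i => (s i : ℝ)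
  filter_upwards [(gaussianPredictors_absolutelyContinuous M N).ae_le hae] with F hF y
  obtain ⟨x, hx⟩ := exists_isEstimate hσ hlam (Matrix.of F) y
  exact ⟨x, hx, fun x' hx' => IsEstimate.unique_of_generalPosition hσ hlam
    (fun T hT j hj s => hF T j s hT hj) hx' hx⟩

end Lasso

theorem mainTheorem4 (M N : ℕ) (hM : 0 < M) (σ lam : ℝ) (hσ : 0 < σ) (hlam : 0 < lam) :
    -- every predictor matrix for which the LASSO estimate is well defined for almost all data
    (∀ F : Matrix (Fin M) (Fin N) ℝ,
      (∀ᵐ y : Fin M → ℝ, ∃! x : Fin N → ℝ, Lasso.IsEstimate σ lam F y x) →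
      ∀ (m : Fin M → ℝ) (xhat : (Fin M → ℝ) → Fin N → ℝ),
        (∀ y, Lasso.IsEstimate σ lam F y (xhat y)) →
        -- the covariance penalty is a genuine covariance, estimated without bias by `‖x̂‖₀ / M`
        (∀ i, MemLp (fun y => Lasso.theta F (xhat y) i) 2 (Lasso.dataLaw σ m)) ∧
        Lasso.IsUnbiased (Lasso.dataLaw σ m) (fun y => Lasso.paramRatio M (xhat y))
          (fun _ => Lasso.covPenalty σ F m xhat) ∧
        -- the generalized degrees of freedom exist and equal `‖x̂‖₀ / M`, almost surely
        (∀ᵐ y ∂(Lasso.dataLaw σ m),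
          DifferentiableAt ℝ (fun y' => Lasso.theta F (xhat y')) y ∧
          Lasso.gdf F xhat y = Lasso.paramRatio M (xhat y)) ∧
        -- `C_p` and AIC agree up to the factor `σ²`, almost surely
        (∀ᵐ y ∂(Lasso.dataLaw σ m), Lasso.Cp σ F xhat y = σ ^ 2 * Lasso.AIC σ F xhat y) ∧
        -- both are unbiased estimators of the in-sample prediction error
        Lasso.IsUnbiased (Lasso.dataLaw σ m) (Lasso.Cp σ F xhat)
          (fun y => 2 * σ ^ 2 * Lasso.errIn σ F m (xhat y)) ∧
        Lasso.IsUnbiased (Lasso.dataLaw σ m) (Lasso.AIC σ F xhat)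
          (fun y => 2 * Lasso.errIn σ F m (xhat y))) ∧
    -- the LASSO estimate is well defined for almost every standard Gaussian predictor matrix
    (∀ᵐ F ∂(Lasso.gaussianPredictors M N),
      ∀ y : Fin M → ℝ, ∃! x : Fin N → ℝ, Lasso.IsEstimate σ lam (Matrix.of F) y x) := by
  exact ⟨fun F huniq m xhat h => Lasso.unbiased_of_ae_unique hM hσ hlam huniq m h,
    Lasso.ae_existsUnique_isEstimate M N hσ hlam⟩
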